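/- For a unital $C^*$-algebra $A$ with unitary group $U(A)$ and a unitary $u$ in the connected component of $1$ in $U(A)$, the $C^*$ exponential length of $u$ is $$\operatorname{cel}(u)=\inf\Big\{\sum_{j=1}^{k}\|h_j\| : k\ge 1,\ h_1,\dots,h_k\in A \text{ selfadjoint},\ u=\exp(ih_1)\exp(ih_2)\cdots\exp(ih_k)\Big\}.$$ Let $A=M_{10}(C[0,1])$ and let $u\in A$ be the diagonal matrix $$u(t)=\operatorname{diag}\big(e^{-2\pi i\cdot\frac{9}{10}t},\,e^{2\pi i\cdot\frac{1}{10}t},\,\dots,\,e^{2\pi i\cdot\frac{1}{10}t}\big),\qquad t\in[0,1],$$ where the entry $e^{2\pi i t/10}$ occurs nine times. Then $u$ is a unitary of $A$, $\det u(t)=1$ for all $t\in[0,1]$, $u$ is homotopic to $1$ (that is, joined to $1$ by a norm-continuous path in $U(A)$), and $$\operatorname{cel}(u)\ \ge\ 2\pi\cdot\frac{9}{10}.$$ Consequently it is not true that every unitary $v\in M_{10}(C[0,1])$ with $\det v(t)=1$ for all $t\in[0,1]$ and $v$ homotopic to $1$ satisfies $\operatorname{cel}(v)\le\pi$. -/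

import Mathlib

open scoped ComplexOrder

noncomputable section

namespace ExpLength

/-- The `C⋆` exponential length of a unitary `u` of a unital `C⋆`-algebra: the infimum of
`‖h₁‖ + ⋯ + ‖hₖ‖` over all ways of writing `u = exp(i h₁) ⋯ exp(i hₖ)` with `h₁, …, hₖ` selfadjoint.
It is meaningful for `u` in the connected component of `1`; elsewhere the set is empty and the
real infimum has the conventional value `0`. -/
def cel {A : Type*} [CStarAlgebra A] (u : unitary A) : ℝ :=
  sInf {L : ℝ | ∃ l : List (selfAdjoint A),
    u = (l.map selfAdjoint.expUnitary).prod ∧ L = (l.map (fun h => ‖(h : A)‖)).sum}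

/-- The `C⋆`-algebra `M₁₀(C[0,1])`. -/
abbrev M10 : Type := CStarMatrix (Fin 10) (Fin 10) C(unitInterval, ℂ)

/-- The scalar matrix `a(t)` for `a ∈ M₁₀(C[0,1])` and `t ∈ [0,1]`. -/
def evalAt (a : M10) (t : unitInterval) : Matrix (Fin 10) (Fin 10) ℂ :=
  Matrix.of fun i j => a i j t

/-- The function `t ↦ exp(2πi c t)` in `C[0,1]`. -/
def phase (c : ℝ) : C(unitInterval, ℂ) where
  toFun t := Complex.exp (2 * (Real.pi : ℂ) * Complex.I * (c : ℂ) * ((t : ℝ) : ℂ))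
  continuous_toFun := by fun_prop

/-- `diag(e^{-2πi·9t/10}, e^{2πi·t/10}, …, e^{2πi·t/10}) ∈ M₁₀(C[0,1])`. -/
def exU : M10 :=
  CStarMatrix.ofMatrix
    (Matrix.diagonal fun i : Fin 10 => if i = 0 then phase (-(9 / 10)) else phase (1 / 10))

end ExpLength

end

/-! Let `u = ∏ exp(i hⱼ)`, `L = ∑ ‖hⱼ‖`, and let `T(t)` be the sum of the normalized traces of the
`hⱼ(t)`. Since `det u = 1`, `10 T(t)` lies in `2πℤ`, hence is a constant `2πm` on the connected
interval. But `u(0) = 1` and `u(1) = exp(2πi/10)` are scalars, and if `L < 2π · 9/10` then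
`le_sum_trace_of_moments` and `sum_trace_le_of_moments` give `T(1) ≥ 2π/10` and `T(0) ≤ 0`,
contradicting constancy.

The trace bounds come from `Im(-τ(log(1 - r u)))`, `r < 1`, for a tracial state `τ`. Positivity of
the Poisson kernel shows that a factor `exp(ig)`, `g ≥ 0`, lowers it by at most `τ(g)/2`
(`logSeries_mul_expUnitary`). Each `hⱼ` becomes positive on adding `‖hⱼ‖`, at the cost of a total
scalar `exp(iL)`. On a scalar `exp(iθ)`, `0 < θ < 2π`, the limit `r → 1` is the sawtooth `(π -
θ)/2`, so comparing the two ends of the product bounds the angle by the trace. -/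

noncomputable section

namespace ExpLength

open Complex NormedSpace

/-! ### Tracial states and the logarithmic series -/

section Tracial

variable {A : Type*} [CStarAlgebra A]

/-- A continuous linear functional which is a tracial state. -/
structure IsTracialState (τ : A →L[ℂ] ℂ) : Prop where
  map_one : τ 1 = 1
  map_mul_comm : ∀ a b, τ (a * b) = τ (b * a)
  map_star : ∀ a, τ (star a) = star (τ a)
  star_mul_self_nonneg : ∀ a, 0 ≤ (τ (star a * a)).re

/-- The series `∑ rᵏ τ(aᵏ) / k` over `k ≥ 1`, which represents `-τ (log (1 - r a))`. -/
def logSeries (τ : A →L[ℂ] ℂ) (r : ℝ) (a : A) : ℂ :=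
  ∑' k : ℕ, ((r : ℂ) ^ (k + 1) / ((k : ℂ) + 1)) * τ (a ^ (k + 1))

/-- Positivity of the Poisson kernel of a unitary against a positive element. -/
lemma half_re_le_re_resolvent {τ : A →L[ℂ] ℂ} (hτ : IsTracialState τ) {x S b : A} {r : ℝ}
    (hr : r ^ 2 ≤ 1) (hx : x * star x = ((r ^ 2 : ℝ) : ℂ) • (1 : A))
    (hS : S * (1 - x) = 1) :
    (τ (star b * b)).re / 2 ≤ (τ (S * (star b * b))).re := by
  have hS2 : (1 - star x) * star S = 1 := by simpa using congrArg star hS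
  -- The Poisson kernel identity: sandwich `1 - x x* = (1 - x*) + (1 - x) - (1 - x)(1 - x*)` between
  -- `S` and `S*`.
  have key : S + star S - 1 = ((1 - r ^ 2 : ℝ) : ℂ) • (S * star S) := by
    have e : S * (1 - x * star x) * star S = S + star S - 1 := by
      have e1 : (1 - x * star x) = (1 - star x) + (1 - x) - (1 - x) * (1 - star x) := by noncomm_ring
      rw [e1]
      calc S * ((1 - star x) + (1 - x) - (1 - x) * (1 - star x)) * star S
          = S * ((1 - star x) * star S) + (S * (1 - x)) * star S
            - (S * (1 - x)) * ((1 - star x) * star S) := by noncomm_ring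
        _ = S + star S - 1 := by rw [hS, hS2]; simp
    rw [← e, hx]
    have : (1 : A) - ((r ^ 2 : ℝ) : ℂ) • (1 : A) = ((1 - r ^ 2 : ℝ) : ℂ) • (1 : A) := by
      push_cast; rw [sub_smul, one_smul]
    rw [this]; simp
  set g := star b * b with hg
  have hgs : star g = g := by simp [hg]
  have h1 : (τ (star S * g)).re = (τ (S * g)).re := by
    have : star (S * g) = g * star S := by simp [hgs]
    rw [hτ.map_mul_comm, ← this, hτ.map_star]; simp
  have h2 : τ (S * star S * g) = τ (star (b * S) * (b * S)) := by
    rw [hg, show S * star S * (star b * b) = S * (star S * star b * b) by noncomm_ring,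
      hτ.map_mul_comm, star_mul]
    simp [mul_assoc]
  have h3 : τ (S * g) + τ (star S * g) - τ g = ((1 - r ^ 2 : ℝ) : ℂ) * τ (S * star S * g) := by
    have := congrArg (fun y => τ (y * g)) key
    simpa [sub_mul, add_mul] using this
  have h4 := congrArg re h3
  rw [re_ofReal_mul, h2] at h4
  simp only [sub_re, add_re, h1] at h4
  have := mul_nonneg (sub_nonneg.2 hr) (hτ.star_mul_self_nonneg (b * S))
  linarith

lemma norm_apply_unitary_pow_mul_le (τ : A →L[ℂ] ℂ) (u : unitary A) (k : ℕ) (g : A) :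
    ‖τ ((u : A) ^ k * g)‖ ≤ ‖τ‖ * ‖g‖ := by
  refine (τ.le_opNorm _).trans_eq ?_
  have := CStarRing.norm_coe_unitary_mul (u ^ k) g
  rw [← this]; simp

lemma summable_logSeries (τ : A →L[ℂ] ℂ) {r : ℝ} (h0 : 0 ≤ r) (h1 : r < 1) (u : unitary A) :
    Summable fun k : ℕ => ((r : ℂ) ^ (k + 1) / ((k : ℂ) + 1)) * τ ((u : A) ^ (k + 1)) := by
  refine Summable.of_norm_bounded (g := fun k : ℕ => r ^ k * (‖τ‖ * ‖(1 : A)‖))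
    ((summable_geometric_of_lt_one h0 h1).mul_right _) fun k => ?_
  have h := norm_apply_unitary_pow_mul_le τ u (k + 1) 1
  rw [mul_one] at h
  rw [norm_mul]
  gcongr
  rw [norm_div, norm_pow, norm_real, Real.norm_of_nonneg h0]
  have : ‖(k : ℂ) + 1‖ = k + 1 := by
    rw [show (k : ℂ) + 1 = ((k + 1 : ℕ) : ℂ) by push_cast; rfl, norm_natCast]; push_cast; rfl
  rw [this, div_le_iff₀ (by positivity), pow_succ]
  have := pow_nonneg h0 k
  gcongr
  nlinarith [(Nat.cast_nonneg k : (0 : ℝ) ≤ k)]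

/-- In the noncommutative Leibniz sum the trace moves all powers of `f s` to one side, so the `k +
1` terms coincide. -/
lemma hasDerivAt_apply_pow {τ : A →L[ℂ] ℂ} (hτ : IsTracialState τ) {f : ℝ → A} {g : A} {s : ℝ}
    (hf : HasDerivAt f (f s * (I • g)) s) (k : ℕ) :
    HasDerivAt (fun y => τ (f y ^ (k + 1))) (((k : ℂ) + 1) * (I * τ (f s ^ (k + 1) * g))) s := by
  have h := (τ.restrictScalars ℝ).hasFDerivAt.comp_hasDerivAt s (hf.fun_pow' (k + 1))
  refine HasDerivAt.congr_deriv h ?_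
  rw [map_sum]
  have : ∀ i ∈ Finset.range (k + 1),
      τ (f s ^ ((k + 1).pred - i) * (f s * (I • g)) * f s ^ i) = I * τ (f s ^ (k + 1) * g) := by
    intro i hi
    have hi' : i ≤ k := by simpa [Nat.lt_succ_iff] using hi
    rw [hτ.map_mul_comm]
    simp only [Nat.pred_succ]
    rw [← mul_assoc, ← mul_assoc, ← pow_add, show i + (k - i) = k by omega, ← pow_succ,
      mul_smul_comm, map_smul, smul_eq_mul]
  refine (Finset.sum_congr rfl this).trans ?_
  simp

lemma hasDerivAt_logSeries {τ : A →L[ℂ] ℂ} (hτ : IsTracialState τ) {r : ℝ} (h0 : 0 ≤ r)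
    (h1 : r < 1) {V : ℝ → unitary A} {g : A}
    (hV : ∀ s, HasDerivAt (fun s => (V s : A)) ((V s : A) * (I • g)) s) (s : ℝ) :
    HasDerivAt (fun s => logSeries τ r (V s : A))
      (∑' k : ℕ, (r : ℂ) ^ (k + 1) * (I * τ ((V s : A) ^ (k + 1) * g))) s := by
  refine hasDerivAt_tsum (𝕜 := ℝ) (u := fun k : ℕ => r ^ (k + 1) * (‖τ‖ * ‖g‖)) (y₀ := 0)
    (g := fun k s => ((r : ℂ) ^ (k + 1) / ((k : ℂ) + 1)) * τ ((V s : A) ^ (k + 1)))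
    (g' := fun k s => (r : ℂ) ^ (k + 1) * (I * τ ((V s : A) ^ (k + 1) * g)))
    ?_ (fun k y => ?_) (fun k y => ?_) ?_ s
  · exact ((summable_nat_add_iff 1).2 (summable_geometric_of_lt_one h0 h1)).mul_right _
  · have h := (hasDerivAt_apply_pow hτ (hV y) k).const_mul ((r : ℂ) ^ (k + 1) / ((k : ℂ) + 1))
    refine h.congr_deriv ?_
    have : (k : ℂ) + 1 ≠ 0 := Nat.cast_add_one_ne_zero k
    field_simp
  · rw [norm_mul, norm_mul, norm_I, one_mul, norm_pow, norm_real, Real.norm_of_nonneg h0]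
    gcongr
    exact norm_apply_unitary_pow_mul_le τ (V y) (k + 1) g
  · exact summable_logSeries τ h0 h1 (V 0)

/-- With `S = (1 - r u)⁻¹` and `g = b* b` the series is `I (τ(S g) - τ(g))`, as its sum starts at
exponent one; `half_re_le_re_resolvent` bounds `Re τ(S g)` below by `τ(g)/2`. -/
lemma deriv_logSeries_bound {τ : A →L[ℂ] ℂ} (hτ : IsTracialState τ) {r : ℝ} (h0 : 0 ≤ r)
    (h1 : r < 1) (u : unitary A) (b : A) :
    -(τ (star b * b)).re / 2 ≤
      (∑' k : ℕ, (r : ℂ) ^ (k + 1) * (I * τ ((u : A) ^ (k + 1) * (star b * b)))).im := by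
  have : Nontrivial A := ⟨1, 0, fun h => by simpa [h] using hτ.map_one⟩
  set g := star b * b with hg
  set x : A := (r : ℂ) • (u : A) with hx
  have hxn : ‖x‖ < 1 := by
    rw [hx, norm_smul, CStarRing.norm_of_mem_unitary u.2]
    simpa [abs_of_nonneg h0] using h1
  have hsum := (summable_geometric_of_norm_lt_one hxn)
  have key := half_re_le_re_resolvent hτ (x := x) (S := ∑' i, x ^ i) (b := b) (r := r)
    (by nlinarith) (by
      rw [hx]; simp [smul_smul, sq, -coe_smul]) (geom_series_mul_neg x hxn)
  rw [← hg] at key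
  have h2 : HasSum (fun i => τ (x ^ i * g)) (τ ((∑' i, x ^ i) * g)) :=
    (hsum.hasSum.mul_right g).mapL τ
  have h3 : HasSum (fun k : ℕ => τ (x ^ (k + 1) * g)) (τ ((∑' i, x ^ i) * g) - τ g) := by
    have := (hasSum_nat_add_iff' 1).2 h2
    simpa using this
  have h4 : ∀ k : ℕ, (r : ℂ) ^ (k + 1) * (I * τ ((u : A) ^ (k + 1) * g))
      = I * τ (x ^ (k + 1) * g) := by
    intro k
    rw [hx, smul_pow, smul_mul_assoc, map_smul, smul_eq_mul]; ring
  rw [tsum_congr h4, (h3.mul_left I).tsum_eq]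
  simp only [I_mul_im, sub_re]
  linarith

lemma hasDerivAt_mul_expUnitary_smul (u : unitary A) (g : selfAdjoint A) (s : ℝ) :
    HasDerivAt (fun s : ℝ => ((u * selfAdjoint.expUnitary (s • g) : unitary A) : A))
      (((u * selfAdjoint.expUnitary (s • g) : unitary A) : A) * (I • (g : A))) s := by
  have h := (hasDerivAt_exp_smul_const (𝕂 := ℝ) (I • (g : A)) s).const_mul (u : A)
  simpa [mul_assoc, smul_comm I] using h

/-- Multiplication by `exp(ig)` with `g ≥ 0` lowers the imaginary part of the series by at most
half the trace of `g`. -/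
lemma logSeries_mul_expUnitary {τ : A →L[ℂ] ℂ} (hτ : IsTracialState τ) {r : ℝ} (h0 : 0 ≤ r)
    (h1 : r < 1) (u : unitary A) (g : selfAdjoint A) {b : A} (hb : (g : A) = star b * b) :
    (logSeries τ r (u : A)).im - (τ g).re / 2 ≤
      (logSeries τ r ((u * selfAdjoint.expUnitary g : unitary A) : A)).im := by
  have hd := fun s => hasDerivAt_logSeries hτ h0 h1
    (V := fun s : ℝ => u * selfAdjoint.expUnitary (s • g)) (hasDerivAt_mul_expUnitary_smul u g) s
  have hd' := fun s => ((imCLM.hasFDerivAt.comp_hasDerivAt s (hd s)).neg.sub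
    ((hasDerivAt_id s).const_mul ((τ g).re / 2)))
  have := antitone_of_hasDerivAt_nonpos hd' (fun s => by
    have := deriv_logSeries_bound hτ h0 h1 (u * selfAdjoint.expUnitary (s • g)) b
    rw [← hb] at this
    simp only [imCLM_apply, Pi.zero_apply, mul_one]
    linarith) zero_le_one
  simp at this
  simp
  linarith

/-! ### Products of exponentials -/

lemma exists_add_norm_eq_star_mul_self (h : selfAdjoint A) :
    ∃ b : A, (h : A) + ((‖(h : A)‖ : ℝ) : ℂ) • (1 : A) = star b * b := by
  let _ := CStarAlgebra.spectralOrder A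
  have := CStarAlgebra.spectralOrderedRing A
  refine CStarAlgebra.nonneg_iff_eq_star_mul_self.1 ?_
  have := h.2.neg_algebraMap_norm_le_self
  rw [Algebra.algebraMap_eq_smul_one] at this
  rw [coe_smul]
  simpa [add_comm] using neg_le_iff_add_nonneg.1 this

/-- The scalar unitary `exp(iθ)`. -/
def scalarUnitary (A : Type*) [CStarAlgebra A] (θ : ℝ) : unitary A :=
  selfAdjoint.expUnitary (θ • (1 : selfAdjoint A))

lemma coe_scalarUnitary (θ : ℝ) : (scalarUnitary A θ : A) = Complex.exp (θ * I) • (1 : A) := by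
  have h : I • ((θ • (1 : selfAdjoint A) : selfAdjoint A) : A) = algebraMap ℂ A (θ * I) := by
    rw [Algebra.algebraMap_eq_smul_one]
    simp [smul_smul, mul_comm, ← coe_smul]
  rw [scalarUnitary, selfAdjoint.expUnitary_coe, h, ← Algebra.algebraMap_eq_smul_one,
    Complex.exp_eq_exp_ℂ]
  exact (algebraMap_exp_comm _).symm

/-- Each factor `exp(ih)` is replaced by `exp(i(h + ‖h‖))`, whose generator is positive; the extra
scalars are central and collect into `exp(iL)`. -/
lemma logSeries_prod_expUnitary {τ : A →L[ℂ] ℂ} (hτ : IsTracialState τ) {r : ℝ} (h0 : 0 ≤ r)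
    (h1 : r < 1) (l : List (selfAdjoint A)) (u : unitary A) :
    (logSeries τ r (u : A)).im -
        ((l.map fun h : selfAdjoint A => (τ (h : A)).re).sum + (l.map fun h : selfAdjoint A => ‖(h : A)‖).sum) / 2 ≤
      (logSeries τ r (Complex.exp ((l.map fun h : selfAdjoint A => ‖(h : A)‖).sum * I) •
        ((u * (l.map selfAdjoint.expUnitary).prod : unitary A) : A))).im := by
  induction l generalizing u with
  | nil => simp
  | cons h l ih =>
    obtain ⟨b, hb⟩ := exists_add_norm_eq_star_mul_self h
    have hg : ((h + ‖(h : A)‖ • (1 : selfAdjoint A) : selfAdjoint A) : A) = star b * b := by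
      rw [← hb]; simp [← coe_smul]
    have e1 := logSeries_mul_expUnitary hτ h0 h1 u _ hg
    have e2 : selfAdjoint.expUnitary (h + ‖(h : A)‖ • (1 : selfAdjoint A))
        = selfAdjoint.expUnitary h * scalarUnitary A ‖(h : A)‖ := by
      refine Commute.expUnitary_add ?_
      simpa using (Commute.one_right (h : A)).smul_right ‖(h : A)‖
    rw [e2] at e1
    have e3 : (τ ((h + ‖(h : A)‖ • (1 : selfAdjoint A) : selfAdjoint A) : A)).re
        = (τ (h : A)).re + ‖(h : A)‖ := by
      rw [hg, ← hb]; simp [hτ.map_one, coe_smul]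
    rw [e3] at e1
    have e4 := ih (u * (selfAdjoint.expUnitary h * scalarUnitary A ‖(h : A)‖))
    have e5 : Complex.exp ((l.map fun h : selfAdjoint A => ‖(h : A)‖).sum * I) •
        ((u * (selfAdjoint.expUnitary h * scalarUnitary A ‖(h : A)‖) *
          (l.map selfAdjoint.expUnitary).prod : unitary A) : A) =
        Complex.exp (((h :: l).map fun h : selfAdjoint A => ‖(h : A)‖).sum * I) •
        ((u * ((h :: l).map selfAdjoint.expUnitary).prod : unitary A) : A) := by
      simp only [List.map_cons, List.sum_cons, List.prod_cons, Submonoid.coe_mul,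
        coe_scalarUnitary, ofReal_add, add_mul, Complex.exp_add]
      simp [smul_smul, mul_assoc, mul_comm]
    rw [e5] at e4
    simp only [List.map_cons, List.sum_cons] at e4 ⊢
    linarith

lemma logSeries_eq_neg_log {τ : A →L[ℂ] ℂ} {r : ℝ} (h0 : 0 ≤ r) (h1 : r < 1) {a : A} {θ : ℝ}
    (ha : ∀ k : ℕ, τ (a ^ k) = Complex.exp (θ * I) ^ k) :
    logSeries τ r a = -Complex.log (1 - r * Complex.exp (θ * I)) := by
  have hz : ‖(r : ℂ) * Complex.exp (θ * I)‖ < 1 := by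
    rw [norm_mul, norm_exp_ofReal_mul_I]; simpa [abs_of_nonneg h0] using h1
  have h := (hasSum_nat_add_iff' 1).2 (hasSum_taylorSeries_neg_log hz)
  simp only [Finset.range_one, Finset.sum_singleton, Nat.cast_zero, div_zero, sub_zero] at h
  rw [← h.tsum_eq]
  refine tsum_congr fun k => ?_
  rw [ha, mul_pow]; push_cast; ring

/-- From `1 - exp(iθ) = 2 sin(θ/2) exp(i(θ - π)/2)`, with positive modulus on this range. -/
lemma arg_one_sub_exp {θ : ℝ} (h0 : 0 < θ) (h1 : θ < 2 * Real.pi) :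
    (1 - Complex.exp (θ * I)).arg = (θ - Real.pi) / 2 := by
  have hs : 0 < 2 * Real.sin (θ / 2) := by
    have := Real.sin_pos_of_pos_of_lt_pi (x := θ / 2) (by linarith) (by linarith)
    linarith
  have key : 1 - Complex.exp (θ * I) = ((2 * Real.sin (θ / 2) : ℝ) : ℂ) *
      (Complex.cos (((θ - Real.pi) / 2 : ℝ) : ℂ) +
        Complex.sin (((θ - Real.pi) / 2 : ℝ) : ℂ) * I) := by
    have c : Real.cos ((θ - Real.pi) / 2) = Real.sin (θ / 2) := by
      rw [sub_div, Real.cos_sub_pi_div_two]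
    have s : Real.sin ((θ - Real.pi) / 2) = -Real.cos (θ / 2) := by
      rw [sub_div, Real.sin_sub_pi_div_two]
    rw [← ofReal_cos, ← ofReal_sin, c, s, exp_mul_I, ← ofReal_cos, ← ofReal_sin]
    have e1 : Real.cos θ = 1 - 2 * Real.sin (θ / 2) ^ 2 := by
      rw [Real.sin_sq_eq_half_sub]; ring_nf
    have e2 : Real.sin θ = 2 * Real.sin (θ / 2) * Real.cos (θ / 2) := by
      rw [← Real.sin_two_mul]; ring_nf
    rw [e1, e2]
    push_cast; ring
  rw [key]
  exact arg_mul_cos_add_sin_mul_I hs ⟨by linarith, by linarith [Real.pi_pos]⟩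

lemma tendsto_log_one_sub_mul_exp {θ : ℝ} (h0 : 0 < θ) (h1 : θ < 2 * Real.pi) :
    Filter.Tendsto (fun r : ℝ => (Complex.log (1 - r * Complex.exp (θ * I))).im)
      (nhdsWithin 1 (Set.Iio 1)) (nhds ((θ - Real.pi) / 2)) := by
  have ha := arg_one_sub_exp h0 h1
  have hsl : (1 - Complex.exp (θ * I)) ∈ slitPlane := by
    rw [mem_slitPlane_iff_arg, ha]
    refine ⟨by linarith [Real.pi_pos], fun h => ?_⟩
    have h' : Complex.exp (θ * I) = 1 := (sub_eq_zero.1 h).symm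
    obtain ⟨n, hn⟩ := Complex.exp_eq_one_iff.1 h'
    have : (θ : ℂ) = ((n * (2 * Real.pi) : ℝ) : ℂ) := by
      apply mul_right_cancel₀ I_ne_zero
      rw [hn]; push_cast; ring
    have hθ : θ = n * (2 * Real.pi) := by exact_mod_cast this
    have hp := Real.pi_pos
    have n0 : (0 : ℝ) < n := by by_contra hc; nlinarith
    have n1 : (n : ℝ) < 1 := by by_contra hc; nlinarith
    have : 0 < n := by exact_mod_cast n0
    have : n < 1 := by exact_mod_cast n1
    omega
  have hc : ContinuousAt (fun r : ℝ => (Complex.log (1 - r * Complex.exp (θ * I))).im) 1 := by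
    refine continuous_im.continuousAt.comp (ContinuousAt.clog ?_ (by simpa using hsl))
    fun_prop
  have := hc.tendsto.mono_left (nhdsWithin_le_nhds (s := Set.Iio 1))
  simpa [log_im, ha] using this

/-- If `∏ exp(i hⱼ)` has the moments of the scalar `exp(iα)` in a tracial state `τ` and
`-L ≤ α < 2π - L` for `L = ∑ ‖hⱼ‖`, then `α ≤ ∑ τ(hⱼ)`. -/
theorem le_sum_trace_of_moments {τ : A →L[ℂ] ℂ} (hτ : IsTracialState τ)
    (l : List (selfAdjoint A)) {α : ℝ}
    (hm : ∀ k : ℕ, τ (((l.map selfAdjoint.expUnitary).prod : unitary A) ^ k : A) =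
      Complex.exp (α * I) ^ k)
    (h0 : -(l.map fun h : selfAdjoint A => ‖(h : A)‖).sum ≤ α)
    (h1 : α < 2 * Real.pi - (l.map fun h : selfAdjoint A => ‖(h : A)‖).sum) :
    α ≤ (l.map fun h : selfAdjoint A => (τ (h : A)).re).sum := by
  set L := (l.map fun h : selfAdjoint A => ‖(h : A)‖).sum with hL
  set T := (l.map fun h : selfAdjoint A => (τ (h : A)).re).sum with hT
  -- With this `ε` the final angle `ε + α + L` is `2π - ε`, so both ends lie in `(0, 2π)`, where the
  -- sawtooth is linear.
  set ε : ℝ := (2 * Real.pi - L - α) / 2 with hε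
  have hL0 : 0 ≤ L := List.sum_nonneg (by simp only [List.mem_map]; rintro _ ⟨h, -, rfl⟩; positivity)
  have hε0 : 0 < ε := by rw [hε]; linarith
  have hε1 : ε < 2 * Real.pi := by rw [hε]; linarith [Real.pi_pos]
  have hstep : ∀ r ∈ Set.Ioo (0 : ℝ) 1,
      -(Complex.log (1 - r * Complex.exp (ε * I))).im - (T + L) / 2 ≤
        -(Complex.log (1 - r * Complex.exp ((ε + α + L : ℝ) * I))).im := by
    intro r hr
    have h := logSeries_prod_expUnitary hτ hr.1.le hr.2 l (scalarUnitary A ε)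
    rw [logSeries_eq_neg_log (θ := ε) hr.1.le hr.2,
      logSeries_eq_neg_log (θ := ε + α + L) hr.1.le hr.2] at h
    · simpa only [neg_im] using h
    · intro k
      rw [Submonoid.coe_mul, coe_scalarUnitary, smul_mul_assoc, one_mul, smul_smul, smul_pow,
        map_smul, hm, smul_eq_mul, ← mul_pow, ← hL]
      congr 1
      rw [← Complex.exp_add, ← Complex.exp_add]
      push_cast; ring_nf
    · intro k
      rw [coe_scalarUnitary, smul_pow, one_pow, map_smul, hτ.map_one, smul_eq_mul, mul_one]
  have t1 := ((tendsto_log_one_sub_mul_exp hε0 hε1).neg.sub_const ((T + L) / 2))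
  have t2 := (tendsto_log_one_sub_mul_exp (θ := ε + α + L) (by linarith)
    (by rw [hε]; linarith)).neg
  have := le_of_tendsto_of_tendsto t1 t2 (by
    filter_upwards [Ioo_mem_nhdsLT (zero_lt_one (α := ℝ))] with r hr using hstep r hr)
  linarith

lemma expUnitary_neg (h : selfAdjoint A) :
    selfAdjoint.expUnitary (-h) = (selfAdjoint.expUnitary h)⁻¹ := by
  rw [eq_inv_iff_mul_eq_one, ← Commute.expUnitary_add (by simp), neg_add_cancel,
    selfAdjoint.expUnitary_zero]

/-- The bound opposite to `le_sum_trace_of_moments`, from the factorization of the inverse. -/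
theorem sum_trace_le_of_moments {τ : A →L[ℂ] ℂ} (hτ : IsTracialState τ)
    (l : List (selfAdjoint A)) {α : ℝ}
    (hm : ∀ k : ℕ, τ (((l.map selfAdjoint.expUnitary).prod : unitary A) ^ k : A) =
      Complex.exp (α * I) ^ k)
    (h0 : α ≤ (l.map fun h : selfAdjoint A => ‖(h : A)‖).sum)
    (h1 : (l.map fun h : selfAdjoint A => ‖(h : A)‖).sum - 2 * Real.pi < α) :
    (l.map fun h : selfAdjoint A => (τ (h : A)).re).sum ≤ α := by
  set l' := (l.map fun h => -h).reverse with hl'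
  have hprod : (l'.map selfAdjoint.expUnitary).prod = (l.map selfAdjoint.expUnitary).prod⁻¹ := by
    rw [List.prod_inv_reverse, hl', List.map_reverse, List.map_map, List.map_map]
    simp only [Function.comp_def, expUnitary_neg]
  have hnorm : (l'.map fun h : selfAdjoint A => ‖(h : A)‖).sum =
      (l.map fun h : selfAdjoint A => ‖(h : A)‖).sum := by
    rw [hl', List.map_reverse, List.sum_reverse, List.map_map]
    simp only [Function.comp_def, NegMemClass.coe_neg, norm_neg]
  have htr : (l'.map fun h : selfAdjoint A => (τ (h : A)).re).sum =
      -(l.map fun h : selfAdjoint A => (τ (h : A)).re).sum := by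
    rw [hl', List.map_reverse, List.sum_reverse, List.map_map, List.sum_neg, List.map_map]
    simp only [Function.comp_def, NegMemClass.coe_neg, map_neg, neg_re]
  have key := le_sum_trace_of_moments hτ l' (α := -α) (fun k => by
    rw [hprod, ← Unitary.star_eq_inv, Unitary.coe_star, ← star_pow, hτ.map_star, hm, star_pow]
    congr 1
    rw [← starRingEnd_apply, ← Complex.exp_conj]
    simp) (by rw [hnorm]; linarith) (by rw [hnorm]; linarith)
  rw [htr] at key
  linarith

/-- Existence of a factorization is needed because the real infimum of the empty set is `0`. -/
lemma le_cel {u : unitary A} {c : ℝ}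
    (hne : ∃ l : List (selfAdjoint A), u = (l.map selfAdjoint.expUnitary).prod)
    (h : ∀ l : List (selfAdjoint A), u = (l.map selfAdjoint.expUnitary).prod →
      c ≤ (l.map fun h : selfAdjoint A => ‖(h : A)‖).sum) : c ≤ cel u := by
  obtain ⟨l, hl⟩ := hne
  refine le_csInf ⟨_, l, hl, rfl⟩ ?_
  rintro _ ⟨l, hl, rfl⟩
  have h := h l hl
  refine h.trans_eq ?_
  simp

end Tracial

/-! ### Pointwise evaluation, determinants and traces -/

lemma continuousStar_of_cstarAlgebra (A : Type*) [CStarAlgebra A] : ContinuousStar A :=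
  inferInstance

instance : ContinuousStar M10 := continuousStar_of_cstarAlgebra M10

/-- Evaluation at a point of the interval, as an algebra homomorphism. -/
def evalHom (t : unitInterval) : M10 →ₐ[ℂ] Matrix (Fin 10) (Fin 10) ℂ where
  toFun a := evalAt a t
  map_one' := by
    ext i j
    simp only [evalAt, Matrix.of_apply, CStarMatrix.one_apply, Matrix.one_apply]
    split_ifs <;> simp
  map_zero' := by ext i j; simp [evalAt]
  map_add' a b := by ext i j; simp [evalAt]
  map_mul' a b := by ext i j; simp [evalAt, CStarMatrix.mul_apply, Matrix.mul_apply]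
  commutes' c := by
    ext i j
    simp only [evalAt, Matrix.of_apply, CStarMatrix.algebraMap_apply, Matrix.algebraMap_matrix_apply]
    split_ifs <;> simp

lemma evalHom_apply_apply (t : unitInterval) (a : M10) (i j : Fin 10) :
    evalHom t a i j = a i j t := rfl

lemma evalHom_star (t : unitInterval) (a : M10) :
    evalHom t (star a) = (evalHom t a).conjTranspose := by
  ext i j
  simp [evalHom_apply_apply, CStarMatrix.star_apply, Matrix.conjTranspose_apply]

lemma continuous_apply_apply (t : unitInterval) (i j : Fin 10) :
    Continuous fun a : M10 => a i j t :=
  (continuous_eval_const t).comp ((continuous_apply j).comp (continuous_apply i))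

lemma continuous_evalHom (t : unitInterval) : Continuous (evalHom t) :=
  continuous_matrix fun i j => continuous_apply_apply t i j

lemma evalHom_exp (t : unitInterval) (a : M10) :
    evalHom t (NormedSpace.exp a) = NormedSpace.exp (evalHom t a) := by
  let : NormedRing (Matrix (Fin 10) (Fin 10) ℂ) := Matrix.linftyOpNormedRing
  let : NormedAlgebra ℚ M10 := .restrictScalars ℚ ℂ M10
  exact NormedSpace.map_exp (evalHom t) (continuous_evalHom t) a

lemma det_exp_of_isHermitian {n : Type*} [Fintype n] [DecidableEq n] {B : Matrix n n ℂ}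
    (hB : B.IsHermitian) : (NormedSpace.exp (I • B)).det = Complex.exp (B.trace * I) := by
  set U : Matrix n n ℂ := (hB.eigenvectorUnitary : Matrix n n ℂ) with hU
  have hUU : U * star U = 1 := by simp [hU]
  have hinv : U⁻¹ = star U := Matrix.inv_eq_right_inv hUU
  have hunit : IsUnit U := IsUnit.of_mul_eq_one _ hUU
  have h1 : I • B = U * Matrix.diagonal (fun i => (hB.eigenvalues i : ℂ) * I) * U⁻¹ := by
    conv_lhs => rw [hB.spectral_theorem, Unitary.conjStarAlgAut_apply]
    rw [hinv, ← smul_mul_assoc, ← mul_smul_comm, ← Matrix.diagonal_smul]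
    congr 3
    ext i; simp [mul_comm]
  rw [h1, Matrix.exp_conj _ _ hunit, Matrix.det_conj hunit, Matrix.exp_diagonal,
    Matrix.det_diagonal, hB.trace_eq_sum_eigenvalues, Finset.sum_mul, Complex.exp_sum]
  refine Finset.prod_congr rfl fun i _ => ?_
  rw [Pi.coe_exp, Complex.exp_eq_exp_ℂ]
  rfl

lemma isHermitian_evalHom (t : unitInterval) (h : selfAdjoint M10) :
    (evalHom t (h : M10)).IsHermitian := by
  rw [Matrix.IsHermitian, ← evalHom_star]
  congr 1
  exact h.2

/-- The normalized trace of the value at `t`. -/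
def normTrace (t : unitInterval) : M10 →L[ℂ] ℂ where
  toLinearMap := (10 : ℂ)⁻¹ • (Matrix.traceLinearMap (Fin 10) ℂ ℂ).comp (evalHom t).toLinearMap
  cont := continuous_const.smul (continuous_evalHom t).matrix_trace

lemma normTrace_apply (t : unitInterval) (a : M10) :
    normTrace t a = (10 : ℂ)⁻¹ * (evalHom t a).trace := rfl

lemma isTracialState_normTrace (t : unitInterval) : IsTracialState (normTrace t) where
  map_one := by simp [normTrace_apply]
  map_mul_comm a b := by rw [normTrace_apply, normTrace_apply, map_mul, map_mul, Matrix.trace_mul_comm]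
  map_star a := by simp [normTrace_apply, evalHom_star, Matrix.trace_conjTranspose]
  star_mul_self_nonneg a := by
    have h := (Matrix.posSemidef_conjTranspose_mul_self (evalHom t a)).trace_nonneg
    rw [normTrace_apply, map_mul, evalHom_star]
    have h' := (Complex.le_def.1 h).1
    rw [show (10 : ℂ)⁻¹ = ((10⁻¹ : ℝ) : ℂ) by push_cast; rfl, re_ofReal_mul]
    exact mul_nonneg (by norm_num) h'

lemma trace_evalHom (t : unitInterval) (h : selfAdjoint M10) :
    (evalHom t (h : M10)).trace = ((10 * (normTrace t (h : M10)).re : ℝ) : ℂ) := by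
  have h1 : star (normTrace t (h : M10)) = normTrace t (h : M10) := by
    rw [← (isTracialState_normTrace t).map_star]
    exact congrArg _ h.2
  have h2 : ((normTrace t (h : M10)).re : ℂ) = normTrace t (h : M10) := conj_eq_iff_re.1 h1
  push_cast
  rw [h2, normTrace_apply]
  ring

lemma det_evalHom_prod_expUnitary (t : unitInterval) (l : List (selfAdjoint M10)) :
    (evalHom t ((l.map selfAdjoint.expUnitary).prod : unitary M10)).det =
      Complex.exp ((10 * (l.map fun h : selfAdjoint M10 => (normTrace t (h : M10)).re).sum : ℝ)
        * I) := by
  induction l with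
  | nil => simp
  | cons h l ih =>
    rw [List.map_cons, List.prod_cons, Submonoid.coe_mul, map_mul, Matrix.det_mul, ih,
      selfAdjoint.expUnitary_coe, evalHom_exp, map_smul,
      det_exp_of_isHermitian (isHermitian_evalHom t h), trace_evalHom, ← Complex.exp_add,
      List.map_cons, List.sum_cons]
    congr 1
    push_cast; ring

lemma continuous_sum_normTrace (l : List (selfAdjoint M10)) : Continuous fun t : unitInterval =>
    (l.map fun h : selfAdjoint M10 => (normTrace t (h : M10)).re).sum := by
  induction l with
  | nil => simpa using continuous_const
  | cons h l ih =>
    simp only [List.map_cons, List.sum_cons]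
    refine Continuous.add ?_ ih
    refine continuous_re.comp (continuous_const.mul ?_)
    change Continuous fun t => ∑ i : Fin 10, (h : M10) i i t
    exact continuous_finsetSum _ fun i _ => ((h : M10) i i).continuous

/-- If `∏ exp(i hⱼ)` has determinant one everywhere, then the total trace is a constant multiple
of `2π`. -/
lemma exists_int_trace_eq (l : List (selfAdjoint M10))
    (hdet : ∀ t, (evalHom t ((l.map selfAdjoint.expUnitary).prod : unitary M10)).det = 1) :
    ∃ m : ℤ, ∀ t : unitInterval,
      10 * (l.map fun h : selfAdjoint M10 => (normTrace t (h : M10)).re).sum =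
        2 * Real.pi * m := by
  have h1 : ∀ t : unitInterval, ∃ m : ℤ,
      10 * (l.map fun h : selfAdjoint M10 => (normTrace t (h : M10)).re).sum =
        2 * Real.pi * m := by
    intro t
    have h := hdet t
    rw [det_evalHom_prod_expUnitary, Complex.exp_eq_one_iff] at h
    obtain ⟨m, hm⟩ := h
    refine ⟨m, ?_⟩
    have : ((10 * (l.map fun h : selfAdjoint M10 => (normTrace t (h : M10)).re).sum : ℝ) : ℂ)
        = ((2 * Real.pi * m : ℝ) : ℂ) := by
      apply mul_right_cancel₀ I_ne_zero
      rw [hm]; push_cast; ring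
    exact_mod_cast this
  choose m hm using h1
  -- Continuity into the discrete space `ℤ` can be tested in `ℝ`; connectedness then makes `m`
  -- constant.
  have hc : Continuous m := by
    rw [Int.isClosedEmbedding_coe_real.isInducing.continuous_iff]
    have : ((↑) : ℤ → ℝ) ∘ m = fun t => (10 *
        (l.map fun h : selfAdjoint M10 => (normTrace t (h : M10)).re).sum) / (2 * Real.pi) := by
      ext t
      rw [hm t]
      have := Real.pi_ne_zero
      simp only [Function.comp]
      field_simp
    rw [this]
    exact (continuous_const.mul (continuous_sum_normTrace l)).div_const _
  exact ⟨m 0, fun t => by rw [hm t, PreconnectedSpace.constant inferInstance hc (x := t) (y := 0)]⟩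

/-! ### The unitary `exU` -/

lemma normTrace_pow_of_scalar {t : unitInterval} {a : M10} {c : ℂ}
    (h : evalHom t a = c • (1 : Matrix (Fin 10) (Fin 10) ℂ)) (k : ℕ) :
    normTrace t (a ^ k) = c ^ k := by
  rw [normTrace_apply, map_pow, h, smul_pow, one_pow, Matrix.trace_smul, Matrix.trace_one]
  simp only [Fintype.card_fin, smul_eq_mul]
  push_cast
  ring

lemma evalHom_exU (t : unitInterval) : evalHom t exU = Matrix.diagonal fun i : Fin 10 =>
    Complex.exp ((2 * Real.pi * (if i = 0 then -(9 / 10) else 1 / 10) * (t : ℝ) : ℝ) * I) := by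
  ext i j
  simp only [evalHom_apply_apply, exU, CStarMatrix.ofMatrix_apply, Matrix.diagonal_apply]
  by_cases hij : i = j
  · rw [if_pos hij, if_pos hij]
    split_ifs <;> simp only [phase, ContinuousMap.coe_mk] <;> congr 1 <;> push_cast <;> ring
  · simp [hij]

lemma det_evalHom_exU (t : unitInterval) : (evalHom t exU).det = 1 := by
  rw [evalHom_exU, Matrix.det_diagonal, ← Complex.exp_sum, ← Finset.sum_mul, ← ofReal_sum]
  rw [Fin.sum_univ_succ]
  have : (2 * Real.pi * (if (0 : Fin 10) = 0 then -(9 / 10) else 1 / 10) * (t : ℝ) +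
      ∑ i : Fin 9, 2 * Real.pi * (if i.succ = 0 then -(9 / 10) else 1 / 10) * (t : ℝ)) = 0 := by
    simp only [if_true, Fin.succ_ne_zero, if_false, Finset.sum_const, Finset.card_univ,
      Fintype.card_fin, nsmul_eq_mul]
    push_cast; ring
  rw [this]; simp

/-- The selfadjoint logarithm of `exU`. -/
def logU : selfAdjoint M10 :=
  ⟨CStarMatrix.ofMatrix (Matrix.diagonal fun i : Fin 10 =>
    ⟨fun t : unitInterval =>
      ((2 * Real.pi * (if i = 0 then -(9 / 10) else 1 / 10) * (t : ℝ) : ℝ) : ℂ), by fun_prop⟩), by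
    rw [selfAdjoint.mem_iff]
    refine CStarMatrix.ext fun i j => ContinuousMap.ext fun t => ?_
    rw [CStarMatrix.star_apply]
    simp only [CStarMatrix.ofMatrix_apply, Matrix.diagonal_apply, ContinuousMap.star_apply]
    by_cases hij : i = j
    · subst hij
      simp only [if_true, ContinuousMap.coe_mk]
      exact conj_ofReal _
    · simp [hij, Ne.symm hij]⟩

lemma evalHom_logU (t : unitInterval) : evalHom t (logU : M10) = Matrix.diagonal fun i : Fin 10 =>
    ((2 * Real.pi * (if i = 0 then -(9 / 10) else 1 / 10) * (t : ℝ) : ℝ) : ℂ) := by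
  ext i j
  simp only [evalHom_apply_apply, logU, CStarMatrix.ofMatrix_apply, Matrix.diagonal_apply]
  by_cases hij : i = j
  · rw [if_pos hij, if_pos hij]; rfl
  · simp [hij]

lemma eq_of_forall_evalHom_eq {a b : M10} (h : ∀ t, evalHom t a = evalHom t b) : a = b :=
  CStarMatrix.ext fun i j => ContinuousMap.ext fun t => congrFun (congrFun (h t) i) j

lemma coe_expUnitary_logU : ((selfAdjoint.expUnitary logU : unitary M10) : M10) = exU := by
  refine eq_of_forall_evalHom_eq fun t => ?_
  rw [selfAdjoint.expUnitary_coe, evalHom_exp, map_smul, evalHom_logU, ← Matrix.diagonal_smul,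
    Matrix.exp_diagonal, evalHom_exU]
  refine congrArg Matrix.diagonal (funext fun i => ?_)
  rw [Pi.coe_exp, Complex.exp_eq_exp_ℂ, Pi.smul_apply, smul_eq_mul, mul_comm I]

/-- Every factorization of `exU` into exponentials has length at least `2π · 9/10`. -/
theorem le_sum_norm_of_prod_eq_exU (l : List (selfAdjoint M10))
    (hl : ((l.map selfAdjoint.expUnitary).prod : unitary M10) = exU) :
    2 * Real.pi * (9 / 10) ≤ (l.map fun h : selfAdjoint M10 => ‖(h : M10)‖).sum := by
  by_contra! hlt
  have hpi := Real.pi_pos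
  have hL0 : 0 ≤ (l.map fun h : selfAdjoint M10 => ‖(h : M10)‖).sum :=
    List.sum_nonneg (by simp only [List.mem_map]; rintro _ ⟨h, -, rfl⟩; positivity)
  obtain ⟨m, hm⟩ := exists_int_trace_eq l fun t => by rw [hl]; exact det_evalHom_exU t
  have hev0 : evalHom 0 exU = Complex.exp ((0 : ℝ) * I) • (1 : Matrix (Fin 10) (Fin 10) ℂ) := by
    rw [evalHom_exU]; simp
  -- The exponents `-9/10` and `1/10` differ by an integer, so at `t = 1` all eigenvalues agree.
  have hev1 : evalHom 1 exU =
      Complex.exp ((2 * Real.pi / 10 : ℝ) * I) • (1 : Matrix (Fin 10) (Fin 10) ℂ) := by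
    rw [evalHom_exU, ← Matrix.diagonal_one, ← Matrix.diagonal_smul]
    congr 1
    ext i
    simp only [Pi.smul_apply, smul_eq_mul, mul_one, Set.Icc.coe_one]
    split_ifs
    · rw [← Complex.exp_periodic.sub_eq (((2 * Real.pi / 10 : ℝ) : ℂ) * I)]
      congr 1; push_cast; ring
    · congr 1; push_cast; ring
  -- Here `α = 2π/10`, and `α < 2π - L` is exactly the assumption `L < 2π · 9/10`. The result forces
  -- `m ≥ 1`, while `t = 0` forces `m ≤ 0`.
  have h1 := le_sum_trace_of_moments (isTracialState_normTrace 1) l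
    (fun k => by rw [hl]; exact normTrace_pow_of_scalar hev1 k) (by linarith) (by linarith)
  have hm1 := hm 1
  have hmpos : (0 : ℝ) < m := by
    by_contra hc; nlinarith
  have hmone : (1 : ℝ) ≤ m := by
    have : 0 < m := by exact_mod_cast hmpos
    exact_mod_cast this
  have h2 := sum_trace_le_of_moments (isTracialState_normTrace 0) l
    (fun k => by rw [hl]; exact normTrace_pow_of_scalar hev0 k) hL0 (by linarith)
  have hm0 := hm 0
  nlinarith

end ExpLength

end

theorem theorem3p11 :
    (∃ hu : ExpLength.exU ∈ unitary ExpLength.M10,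
      (∀ t : unitInterval, (ExpLength.evalAt ExpLength.exU t).det = 1) ∧
      Joined (⟨ExpLength.exU, hu⟩ : unitary ExpLength.M10) 1 ∧
      2 * Real.pi * (9 / 10) ≤ ExpLength.cel (⟨ExpLength.exU, hu⟩ : unitary ExpLength.M10)) ∧
    ¬ ∀ v : unitary ExpLength.M10,
      (∀ t : unitInterval, (ExpLength.evalAt (v : ExpLength.M10) t).det = 1) →
      Joined v 1 → ExpLength.cel v ≤ Real.pi := by
  have hu : ExpLength.exU ∈ unitary ExpLength.M10 :=
    ExpLength.coe_expUnitary_logU ▸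
      (selfAdjoint.expUnitary ExpLength.logU : unitary ExpLength.M10).2
  have he : (⟨ExpLength.exU, hu⟩ : unitary ExpLength.M10) =
      selfAdjoint.expUnitary ExpLength.logU := Subtype.ext ExpLength.coe_expUnitary_logU.symm
  have hdet : ∀ t : unitInterval, (ExpLength.evalAt ExpLength.exU t).det = 1 :=
    ExpLength.det_evalHom_exU
  have hj : Joined (⟨ExpLength.exU, hu⟩ : unitary ExpLength.M10) 1 :=
    he ▸ (selfAdjoint.joined_one_expUnitary ExpLength.logU).symm
  have hcel : 2 * Real.pi * (9 / 10) ≤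
      ExpLength.cel (⟨ExpLength.exU, hu⟩ : unitary ExpLength.M10) := by
    refine ExpLength.le_cel ⟨[ExpLength.logU], by simpa using he⟩ fun l hl => ?_
    exact ExpLength.le_sum_norm_of_prod_eq_exU l (congrArg Subtype.val hl).symm
  refine ⟨⟨hu, hdet, hj, hcel⟩, fun h => ?_⟩
  have := hcel.trans (h _ hdet hj)
  linarith [Real.pi_pos]
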